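/- Let $f\colon\mathbb{C}\to\mathbb{C}$, $f(z)=e^z$, be the complex exponential map, and for $n\ge 1$ let $f^n$ denote its $n$-th iterate $f\circ\dots\circ f$ ($n$ times). Let $U\subset\mathbb{C}$ be open and nonempty. Then $U$ contains a repelling periodic point of $f$; that is, there exist a point $p\in U$ and an integer $n\ge 1$ such that $f^n(p)=p$ and $|(f^n)'(p)|>1$. -/

import Mathlib

/-! Take `d ≠ 0` in `U` and a small disk D about it. Some point of D has a real iterate
(`exists_im_exp_iterate_eq_zero`), and real orbits tend to +∞, where logarithms contract. So for
arbitrarily large real x an inverse branch maps the disk of radius 6 about x into D with tiny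
Lipschitz constant (`exists_branch_into_nhds`), while a double logarithm carries D into that disk
(`exists_branch_two_near_real`). The composite is a contracting inverse branch from D to D, and its
Banach fixed point is repelling.

For the density, suppose no iterate is real anywhere on a disk. Schwarz's lemma bounds |(f^n)'| /
|Im f^n| at the centre, a quantity that is nondecreasing because |sin y| ≤ |y|. Its convergence
forces |Im f^n| ≤ 1/4 eventually; then Re f^n grows, |Im f^n| doubles at each step, and this is
absurd. -/

/-! ### Inverse branches of iterates -/

/-- `g` is a right inverse of `exp^[n]` on `S`, Lipschitz with constant `C` there. -/
structure ExpInvBranch (n : ℕ) (g : ℂ → ℂ) (S : Set ℂ) (C : ℝ) : Prop where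
  right_inv : ∀ z ∈ S, Complex.exp^[n] (g z) = z
  lipschitz : ∀ z ∈ S, ∀ z' ∈ S, ‖g z - g z'‖ ≤ C * ‖z - z'‖

theorem ExpInvBranch.comp {n m : ℕ} {g h : ℂ → ℂ} {S T : Set ℂ} {C C' : ℝ}
    (hg : ExpInvBranch n g T C) (hh : ExpInvBranch m h S C') (hC : 0 ≤ C)
    (hST : ∀ z ∈ S, h z ∈ T) : ExpInvBranch (m + n) (g ∘ h) S (C * C') where
  right_inv z hz := by
    rw [Function.iterate_add_apply, Function.comp_apply, hg.right_inv _ (hST z hz),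
      hh.right_inv z hz]
  lipschitz z hz z' hz' := by
    rw [mul_assoc]
    exact (hg.lipschitz _ (hST z hz) _ (hST z' hz')).trans
      (mul_le_mul_of_nonneg_left (hh.lipschitz z hz z' hz') hC)

/-- The branch of the logarithm on a disk staying at distance `c` from the origin. -/
theorem exists_log_branch {v w : ℂ} {r c : ℝ} (hc : 0 < c) (hw : r + c ≤ ‖w‖)
    (hv : Complex.exp v = w) :
    ∃ g : ℂ → ℂ, g w = v ∧ ExpInvBranch 1 g (Metric.closedBall w r) c⁻¹ := by
  have hw0 : w ≠ 0 := by rw [← hv]; exact Complex.exp_ne_zero v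
  have hwpos : 0 < ‖w‖ := norm_pos_iff.mpr hw0
  have hnorm : ∀ z ∈ Metric.closedBall w r, c ≤ ‖z‖ := fun z hz => by
    have h1 : ‖z - w‖ ≤ r := by simpa [dist_eq_norm] using hz
    have h2 := norm_sub_norm_le w z
    rw [norm_sub_rev] at h2
    linarith
  have hslit : ∀ z ∈ Metric.closedBall w r, z / w ∈ Complex.slitPlane := fun z hz => by
    refine Complex.mem_slitPlane_of_norm_lt_one (z := z / w - 1) ?_ |> fun h => by simpa using h
    have h1 : ‖z - w‖ ≤ r := by simpa [dist_eq_norm] using hz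
    have : z / w - 1 = (z - w) / w := by field_simp
    rw [this, norm_div, div_lt_one hwpos]
    linarith
  -- Dividing by `w` moves the disk inside |ζ - 1| < 1, where the principal logarithm is
  -- holomorphic.
  refine ⟨fun z => v + Complex.log (z / w), by simp [hw0], ?_, ?_⟩
  · intro z hz
    have hz0 : z ≠ 0 := norm_pos_iff.mp (hc.trans_le (hnorm z hz))
    rw [Function.iterate_one, Complex.exp_add, hv, Complex.exp_log (div_ne_zero hz0 hw0)]
    field_simp
  · intro z hz z' hz'
    have hd : ∀ x ∈ Metric.closedBall w r, HasDerivWithinAt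
        (fun z => v + Complex.log (z / w)) x⁻¹ (Metric.closedBall w r) x := fun x hx => by
      have hx0 : x ≠ 0 := norm_pos_iff.mp (hc.trans_le (hnorm x hx))
      have := (((hasDerivAt_id' x).div_const w).clog (hslit x hx)).const_add v
      refine HasDerivAt.hasDerivWithinAt ?_
      convert this using 1
      rw [div_div_div_cancel_right₀ hw0, one_div]
    refine (convex_closedBall w r).norm_image_sub_le_of_norm_hasDerivWithin_le hd
      (fun x hx => ?_) hz' hz
    rw [norm_inv]
    exact inv_anti₀ hc (hnorm x hx)

/-- Distance 2 from the origin makes each logarithm 1/2-Lipschitz, so pulled-back disks never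
outgrow radius `r` and the next logarithm applies. -/
theorem exists_branch_of_large_orbit {r : ℝ} (hr : 0 ≤ r) (j : ℕ) :
    ∀ w : ℂ, (∀ i < j, r + 2 ≤ ‖Complex.exp^[i + 1] w‖) →
    ∃ g : ℂ → ℂ, g (Complex.exp^[j] w) = w ∧
      ExpInvBranch j g (Metric.closedBall (Complex.exp^[j] w) r) ((2⁻¹ : ℝ) ^ j) := by
  induction j with
  | zero => exact fun w _ => ⟨id, rfl, fun z _ => rfl, fun z _ z' _ => by simp⟩
  | succ j ih =>
    intro w hw
    obtain ⟨g, hg, hgb⟩ := ih (Complex.exp w) fun i hi => by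
      simpa using hw (i + 1) (by omega)
    obtain ⟨l, hl, hlb⟩ := exists_log_branch two_pos (by simpa using hw 0 (by omega)) (rfl :
      Complex.exp w = _)
    refine ⟨l ∘ g, by simp [hg, hl], ?_⟩
    rw [Function.iterate_succ_apply, pow_succ']
    refine hlb.comp hgb (by positivity) fun z hz => ?_
    have hr' : Complex.exp^[j] (Complex.exp w) ∈
      Metric.closedBall (Complex.exp^[j] (Complex.exp w)) r := Metric.mem_closedBall_self hr
    have := hgb.lipschitz z hz _ hr'
    rw [hg] at this
    rw [Metric.mem_closedBall, dist_eq_norm] at hz ⊢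
    have h2 : (2⁻¹ : ℝ) ^ j ≤ 1 := pow_le_one₀ (by norm_num) (by norm_num)
    nlinarith [norm_nonneg (z - Complex.exp^[j] (Complex.exp w))]

/-- Handles the initial orbit segment, where nothing bounds the orbit away from 0: `C` may be large,
to be beaten later by powers of 1/2. -/
theorem exists_local_branch (n : ℕ) : ∀ (w : ℂ) (U : Set ℂ), IsOpen U → w ∈ U →
    ∃ ρ > 0, ∃ C > 0, ∃ g : ℂ → ℂ,
      ExpInvBranch n g (Metric.closedBall (Complex.exp^[n] w) ρ) C ∧
      ∀ z ∈ Metric.closedBall (Complex.exp^[n] w) ρ, g z ∈ U := by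
  induction n with
  | zero =>
    intro w U hU hw
    obtain ⟨ρ, hρ, h⟩ := Metric.nhds_basis_closedBall.mem_iff.mp (hU.mem_nhds hw)
    exact ⟨ρ, hρ, 1, one_pos, id, ⟨fun z _ => rfl, fun z _ z' _ => by simp⟩, fun z hz => h hz⟩
  | succ n ih =>
    intro w U hU hw
    obtain ⟨ε, hε, h⟩ := Metric.isOpen_iff.mp hU w hw
    have hpos : 0 < ‖Complex.exp w‖ := norm_pos_iff.mpr (Complex.exp_ne_zero w)
    set a := ‖Complex.exp w‖ / 2 with ha
    have ha0 : 0 < a := by positivity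
    obtain ⟨l, hl, hlb⟩ := exists_log_branch (r := a) ha0 (by rw [ha]; linarith) (rfl :
      Complex.exp w = _)
    obtain ⟨ρ, hρ, C, hC, g, hgb, hgU⟩ := ih (Complex.exp w)
      (Metric.ball (Complex.exp w) (min a (a * ε))) Metric.isOpen_ball
      (Metric.mem_ball_self (by positivity))
    have hball : ∀ z ∈ Metric.ball (Complex.exp w) (min a (a * ε)),
        z ∈ Metric.closedBall (Complex.exp w) a := fun z hz =>
      Metric.mem_closedBall.mpr ((Metric.mem_ball.mp hz).le.trans (min_le_left _ _))
    refine ⟨ρ, hρ, a⁻¹ * C, by positivity, l ∘ g,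
      hlb.comp hgb (by positivity) fun z hz => hball _ (hgU z hz), fun z hz => h ?_⟩
    have h1 := hlb.lipschitz _ (hball _ (hgU z hz)) _ (Metric.mem_closedBall_self ha0.le)
    have h2 := (Metric.mem_ball.mp (hgU z hz)).trans_le (min_le_right _ _)
    rw [dist_eq_norm] at h2
    rw [hl] at h1
    rw [Metric.mem_ball, dist_eq_norm, Function.comp_apply]
    refine h1.trans_lt ?_
    rwa [inv_mul_lt_iff₀ ha0]

/-! ### Repelling fixed points -/

/-- A contracting inverse branch of `exp^[n]` mapping a disk into itself yields a repelling
periodic point. -/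
theorem ExpInvBranch.exists_repelling {n : ℕ} {g : ℂ → ℂ} {d : ℂ} {δ : ℝ} (hδ : 0 < δ)
    (hg : ExpInvBranch n g (Metric.closedBall d δ) 2⁻¹)
    (hmaps : ∀ z ∈ Metric.closedBall d δ, g z ∈ Metric.ball d δ) :
    ∃ p ∈ Metric.ball d δ, Function.IsPeriodicPt Complex.exp n p ∧
      1 < ‖deriv (Complex.exp^[n]) p‖ := by
  have hm : Set.MapsTo g (Metric.closedBall d δ) (Metric.closedBall d δ) :=
    fun z hz => Metric.ball_subset_closedBall (hmaps z hz)
  have hcontr : ContractingWith 2⁻¹ (hm.restrict g _ _) := by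
    refine ⟨by rw [← NNReal.coe_lt_coe]; norm_num, LipschitzWith.of_dist_le_mul fun x y => ?_⟩
    have := hg.lipschitz x x.2 y y.2
    simpa [Subtype.dist_eq, dist_eq_norm] using this
  have hcomplete : IsComplete (Metric.closedBall d δ) :=
    (isCompact_closedBall d δ).isComplete
  obtain ⟨p, hp, hfix, -⟩ := hcontr.exists_fixedPoint' hcomplete hm
    (Metric.mem_closedBall_self hδ.le) (edist_ne_top _ _)
  have hfix' : g p = p := hfix
  have hpb : p ∈ Metric.ball d δ := hfix' ▸ hmaps p hp
  refine ⟨p, hpb, ?_, ?_⟩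
  · have := hg.right_inv p hp
    rwa [hfix'] at this
  · by_contra! hle
    have hdiff : ContDiff ℂ 1 (Complex.exp^[n]) :=
      (Complex.differentiable_exp.iterate n).contDiff
    have hs : HasStrictDerivAt (Complex.exp^[n]) (deriv (Complex.exp^[n]) p) p :=
      hdiff.contDiffAt.hasStrictDerivAt one_ne_zero
    -- A derivative of norm at most 1 makes the iterate 3/2-Lipschitz near `p`; composed with the
    -- 1/2-Lipschitz `g` this gives t ≤ (3/4)t.
    have hlt : ‖ContinuousLinearMap.toSpanSingleton ℂ (deriv (Complex.exp^[n]) p)‖₊ <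
        (3 / 2 : NNReal) := by
      rw [← NNReal.coe_lt_coe, coe_nnnorm, ContinuousLinearMap.norm_toSpanSingleton]
      refine hle.trans_lt ?_
      norm_num
    obtain ⟨s, hsn, hlip⟩ :=
      hs.hasStrictFDerivAt.exists_lipschitzOnWith_of_nnnorm_lt _ hlt
    obtain ⟨ε, hε, hεs⟩ := Metric.mem_nhds_iff.mp hsn
    obtain ⟨η, hη, hηs⟩ := Metric.isOpen_iff.mp Metric.isOpen_ball p hpb
    set t := min ε η / 2 with ht
    have ht0 : 0 < t := by positivity
    have htε : t < ε := by have := min_le_left ε η; linarith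
    have htη : t < η := by have := min_le_right ε η; linarith
    have hz : p + t ∈ Metric.closedBall d δ :=
      Metric.ball_subset_closedBall (hηs (by simp [abs_of_pos ht0, htη]))
    have h1 := hg.lipschitz _ hz _ hp
    rw [hfix'] at h1
    have hn : ‖p + t - p‖ = t := by simp [abs_of_pos ht0]
    rw [hn] at h1
    have h2 := hlip.dist_le_mul (g (p + t)) (hεs (by
      rw [Metric.mem_ball, dist_eq_norm]; linarith)) p (hεs (Metric.mem_ball_self hε))
    rw [hg.right_inv _ hz, dist_eq_norm, dist_eq_norm] at h2
    have h3 := hg.right_inv p hp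
    rw [hfix'] at h3
    rw [h3, hn] at h2
    push_cast at h2
    linarith

/-! ### Density of preimages of the real axis -/

/-- The Taylor bound leaves a deficit of at least (11/96)y³, and y² ≥ 1/16. -/
theorem Real.sin_le_mul_of_mem_Icc {y : ℝ} (h1 : 1 / 4 ≤ y) (h2 : y ≤ 1) :
    Real.sin y ≤ (1 - 11 / 1536) * y := by
  have h := (abs_le.mp (Real.sin_bound (abs_le.mpr ⟨by linarith, h2⟩))).2
  rw [abs_of_nonneg (by linarith : 0 ≤ y)] at h
  have : y ^ 5 ≤ y ^ 3 := pow_le_pow_of_le_one (by linarith) h2 (by norm_num)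
  have : 1 / 16 * y ≤ y ^ 3 := by
    have h3 : 1 / 16 ≤ y ^ 2 := by nlinarith
    calc 1 / 16 * y ≤ y ^ 2 * y := mul_le_mul_of_nonneg_right h3 (by linarith)
      _ = y ^ 3 := by ring
  linarith

theorem Real.abs_sin_le_mul {y : ℝ} (h : 1 / 4 ≤ |y|) :
    |Real.sin y| ≤ (1 - 11 / 1536) * |y| := by
  wlog hy : 0 ≤ y generalizing y
  · simpa using this (y := -y) (by simpa using h) (by linarith)
  rw [abs_of_nonneg hy] at h ⊢
  rcases le_total 2 y with h2 | h2
  · exact (Real.abs_sin_le_one y).trans (by linarith)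
  rw [abs_of_nonneg (Real.sin_nonneg_of_nonneg_of_le_pi hy (by linarith [Real.pi_gt_three]))]
  rcases le_total y 1 with h1 | h1
  · exact Real.sin_le_mul_of_mem_Icc h h1
  · have h3 := Real.sin_le_mul_of_mem_Icc (y := y / 2) (by linarith) (by linarith)
    have h4 : Real.sin y = 2 * Real.sin (y / 2) * Real.cos (y / 2) := by
      rw [← Real.sin_two_mul]; congr 1; ring
    have h5 := Real.sin_nonneg_of_nonneg_of_le_pi (x := y / 2) (by linarith)
      (by linarith [Real.pi_gt_three])
    nlinarith [Real.cos_le_one (y / 2)]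

theorem norm_deriv_exp_iterate_succ (n : ℕ) (z : ℂ) :
    ‖deriv (Complex.exp^[n + 1]) z‖ =
      ‖deriv (Complex.exp^[n]) z‖ * Real.exp (Complex.exp^[n] z).re := by
  have hd : DifferentiableAt ℂ (Complex.exp^[n]) z :=
    (Complex.differentiable_exp.iterate n).differentiableAt
  rw [Function.iterate_succ', ((Complex.hasDerivAt_exp _).comp z hd.hasDerivAt).deriv, norm_mul,
    Complex.norm_exp, mul_comm]

/-- Schwarz's lemma for maps of a disk into the upper half-plane. -/
theorem norm_deriv_le_of_im_pos {g : ℂ → ℂ} {z : ℂ} {δ : ℝ} (hδ : 0 < δ)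
    (hg : DifferentiableOn ℂ g (Metric.ball z δ)) (him : ∀ x ∈ Metric.ball z δ, 0 < (g x).im) :
    ‖deriv g z‖ ≤ 2 / δ * (g z).im := by
  have hz := Metric.mem_ball_self (x := z) hδ
  have hzim := him z hz
  set b := g z with hb
  have hne : ∀ x ∈ Metric.ball z δ, g x - starRingEnd ℂ b ≠ 0 := fun x hx h0 => by
    have := congrArg Complex.im h0
    simp at this
    linarith [him x hx]
  have hgd : DifferentiableAt ℂ g z := hg.differentiableAt (Metric.ball_mem_nhds z hδ)
  -- Cayley transform of the half-plane onto the unit disk, sending `b` to 0.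
  set h : ℂ → ℂ := fun x => (g x - b) / (g x - starRingEnd ℂ b) with hh
  have hhd : DifferentiableOn ℂ h (Metric.ball z δ) :=
    (hg.sub_const b).div (hg.sub_const _) hne
  have hmaps : Set.MapsTo h (Metric.ball z δ) (Metric.ball (h z) 1) := fun x hx => by
    have h0 : h z = 0 := by simp [hh, hb]
    rw [h0, mem_ball_zero_iff, hh, norm_div, div_lt_one (norm_pos_iff.mpr (hne x hx)),
      ← sq_lt_sq₀ (norm_nonneg _) (norm_nonneg _), ← Complex.normSq_eq_norm_sq,
      ← Complex.normSq_eq_norm_sq, Complex.normSq_apply, Complex.normSq_apply]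
    simp
    nlinarith [him x hx]
  have hle := Complex.norm_deriv_le_div_of_mapsTo_ball hhd
    (hmaps.mono_right Metric.ball_subset_closedBall) hδ
  have hderiv : deriv h z = deriv g z / (b - starRingEnd ℂ b) := by
    have := ((hgd.hasDerivAt.sub_const b).div (hgd.hasDerivAt.sub_const (starRingEnd ℂ b))
      (hne z hz)).deriv
    have hne' := hne z hz
    rw [← hb] at this hne'
    rw [hh]
    refine this.trans ?_
    field_simp
    ring
  rw [hderiv, norm_div, Complex.sub_conj] at hle
  simp only [norm_mul, Complex.norm_I, Complex.norm_real, mul_one, Real.norm_eq_abs] at hle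
  rw [abs_two, abs_of_pos hzim, div_le_div_iff₀ (by linarith) hδ] at hle
  rw [div_mul_eq_mul_div, le_div_iff₀ hδ]
  linarith

theorem norm_deriv_le_of_im_ne_zero {g : ℂ → ℂ} {z : ℂ} {δ : ℝ} (hδ : 0 < δ)
    (hg : DifferentiableOn ℂ g (Metric.ball z δ)) (him : ∀ x ∈ Metric.ball z δ, (g x).im ≠ 0) :
    ‖deriv g z‖ ≤ 2 / δ * |(g z).im| := by
  have hz := Metric.mem_ball_self (x := z) hδ
  have hconn : IsPreconnected ((fun x => (g x).im) '' Metric.ball z δ) :=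
    (convex_ball z δ).isPreconnected.image _
      (Complex.continuous_im.comp_continuousOn hg.continuousOn)
  have hsign : ∀ x ∈ Metric.ball z δ, ∀ y ∈ Metric.ball z δ, 0 < (g x).im → 0 < (g y).im := by
    intro x hx y hy h0
    by_contra! hle
    obtain ⟨t, ht, h⟩ := hconn.Icc_subset (Set.mem_image_of_mem _ hy) (Set.mem_image_of_mem _ hx)
      ⟨hle, h0.le⟩
    exact him t ht h
  rcases (him z hz).lt_or_gt with hlt | hgt
  · have := norm_deriv_le_of_im_pos hδ hg.neg fun x hx => by
      have := (him x hx).lt_or_gt.resolve_right fun h => (hsign x hx z hz h).not_gt hlt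
      simpa using this
    simpa [deriv.neg, abs_of_neg hlt] using this
  · rw [abs_of_pos hgt]
    exact norm_deriv_le_of_im_pos hδ hg fun x hx => hsign z hz x hx hgt

/-- The ratio `a (n + 1) / a n` equals |y| / |sin y|. Since `a` increases to a finite limit, the
ratio cannot keep exceeding 1 by a fixed factor, as it does whenever |y| > 1/4. -/
theorem eventually_abs_im_le {z : ℂ} {δ : ℝ} (hδ : 0 < δ)
    (him : ∀ n : ℕ, ∀ x ∈ Metric.ball z δ, (Complex.exp^[n] x).im ≠ 0) :
    ∀ᶠ n in Filter.atTop, |(Complex.exp^[n] z).im| ≤ 1 / 4 := by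
  have hz := Metric.mem_ball_self (x := z) hδ
  set y : ℕ → ℝ := fun n => |(Complex.exp^[n] z).im| with hy
  have hypos : ∀ n, 0 < y n := fun n => abs_pos.mpr (him n z hz)
  set a : ℕ → ℝ := fun n => ‖deriv (Complex.exp^[n]) z‖ / y n with ha
  have hsucc : ∀ n, y (n + 1) =
      Real.exp (Complex.exp^[n] z).re * |Real.sin (Complex.exp^[n] z).im| := fun n => by
    simp only [hy, Function.iterate_succ_apply', Complex.exp_im, abs_mul, Real.abs_exp]
  have hsin : ∀ n, 0 < |Real.sin (Complex.exp^[n] z).im| := fun n => by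
    have := hypos (n + 1)
    rw [hsucc] at this
    exact pos_of_mul_pos_right this (Real.exp_pos _).le
  have hapos : ∀ n, 0 < a n := fun n => by
    refine div_pos ?_ (hypos n)
    induction n with
    | zero => simp
    | succ n ih => rw [norm_deriv_exp_iterate_succ]; positivity
  have hstep : ∀ n, a (n + 1) * |Real.sin (Complex.exp^[n] z).im| = a n * y n := fun n => by
    have h1 := (hypos n).ne'
    have h2 := (hsin n).ne'
    simp only [ha]
    rw [hsucc, norm_deriv_exp_iterate_succ]
    field_simp
  have hmono : Monotone a := monotone_nat_of_le_succ fun n => by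
    have h1 : |Real.sin (Complex.exp^[n] z).im| ≤ y n := Real.abs_sin_le_abs
    have h2 := hstep n
    have h3 := hsin n
    by_contra! hlt
    nlinarith [hapos (n + 1), hapos n]
  have hbdd : BddAbove (Set.range a) := ⟨2 / δ, by
    rintro _ ⟨n, rfl⟩
    rw [div_le_iff₀ (hypos n)]
    exact norm_deriv_le_of_im_ne_zero hδ
      (Complex.differentiable_exp.iterate n).differentiableOn (him n)⟩
  have hlim := tendsto_atTop_ciSup hmono hbdd
  set L := ⨆ i, a i with hL
  have hLpos : 0 < L := (hapos 0).trans_le (le_ciSup hbdd 0)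
  filter_upwards [hlim.eventually_const_lt (show (1 - 11 / 1536) * L < L by linarith)] with n hn
  by_contra! hlt
  have h1 : |Real.sin (Complex.exp^[n] z).im| ≤ (1 - 11 / 1536) * y n :=
    Real.abs_sin_le_mul hlt.le
  have h2 := hstep n
  have h3 : a (n + 1) ≤ L := le_ciSup hbdd (n + 1)
  have h4 : a n * y n ≤ L * ((1 - 11 / 1536) * y n) := by
    rw [← h2]
    exact mul_le_mul h3 h1 (hsin n).le hLpos.le
  nlinarith [hypos n]

/-- Preimages of the real axis under the iterates of `exp` are dense. -/
theorem exists_im_exp_iterate_eq_zero {z : ℂ} {δ : ℝ} (hδ : 0 < δ) :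
    ∃ x ∈ Metric.ball z δ, ∃ n : ℕ, (Complex.exp^[n] x).im = 0 := by
  by_contra! him
  obtain ⟨N, hN⟩ := Filter.eventually_atTop.mp
    (eventually_abs_im_le hδ fun n x hx => him x hx n)
  set x : ℕ → ℝ := fun n => (Complex.exp^[N + n] z).re with hx
  set y : ℕ → ℝ := fun n => (Complex.exp^[N + n] z).im with hy
  have hy4 : ∀ n, |y n| ≤ 1 / 4 := fun n => hN _ (by omega)
  have hy0 : ∀ n, y n ≠ 0 := fun n => him z (Metric.mem_ball_self hδ) _
  have hxs : ∀ n, x (n + 1) = Real.exp (x n) * Real.cos (y n) := fun n => by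
    simp only [hx, hy, ← add_assoc, Function.iterate_succ_apply', Complex.exp_re]
  have hys : ∀ n, y (n + 1) = Real.exp (x n) * Real.sin (y n) := fun n => by
    simp only [hx, hy, ← add_assoc, Function.iterate_succ_apply', Complex.exp_im]
  have hcos : ∀ n, 9 / 10 ≤ Real.cos (y n) := fun n => by
    have h1 := Real.one_sub_sq_div_two_le_cos (x := y n)
    have h2 := sq_abs (y n)
    nlinarith [hy4 n, abs_nonneg (y n)]
  have hxpos : ∀ n, 0 ≤ x (n + 1) := fun n => by
    rw [hxs]; exact mul_nonneg (Real.exp_pos _).le (by linarith [hcos n])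
  have hgrow : ∀ n : ℕ, (n : ℝ) * (4 / 5) ≤ x (n + 1) := fun n => by
    induction n with
    | zero => simpa using hxpos 0
    | succ n ih =>
      have h1 := Real.quadratic_le_exp_of_nonneg (hxpos n)
      rw [hxs (n + 1)]
      push_cast
      nlinarith [hcos (n + 1), hxpos n, sq_nonneg (x (n + 1) - 1),
        mul_le_mul h1 (hcos (n + 1)) (by norm_num) (Real.exp_pos _).le]
  -- By index 5 the real part is at least 16/5, so the exponential exceeds 4; Jordan's inequality
  -- loses at most a factor 2.
  have hdouble : ∀ n, 2 * |y (n + 5)| ≤ |y (n + 6)| := fun n => by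
    have h1 : 4 ≤ Real.exp (x (n + 5)) := by
      have := hgrow (n + 4)
      push_cast at this
      linarith [Real.add_one_le_exp (x (n + 5)), Nat.cast_nonneg (α := ℝ) n]
    have h2 := Real.mul_abs_le_abs_sin (x := y (n + 5))
      (by linarith [hy4 (n + 5), Real.pi_gt_three])
    have h3 : 1 / 2 ≤ 2 / Real.pi := by
      rw [div_le_div_iff₀ two_pos Real.pi_pos]; linarith [Real.pi_lt_four]
    rw [hys (n + 5), abs_mul, Real.abs_exp]
    have h4 : 1 / 2 * |y (n + 5)| ≤ |Real.sin (y (n + 5))| :=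
      (mul_le_mul_of_nonneg_right h3 (abs_nonneg _)).trans h2
    nlinarith [abs_nonneg (y (n + 5))]
  have hpow : ∀ n, (2 : ℝ) ^ n * |y 5| ≤ |y (n + 5)| := fun n => by
    induction n with
    | zero => simp
    | succ n ih =>
      have := hdouble n
      rw [pow_succ, show n + 1 + 5 = n + 6 by ring]
      linarith
  have hy5 : 0 < |y 5| := abs_pos.mpr (hy0 5)
  obtain ⟨n, hn⟩ := pow_unbounded_of_one_lt (1 / |y 5|) (one_lt_two (α := ℝ))
  rw [div_lt_iff₀ hy5] at hn
  linarith [hpow n, hy4 (n + 5)]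

/-! ### Real orbits and the return branch -/

theorem exp_iterate_ofReal (n : ℕ) (x : ℝ) :
    Complex.exp^[n] (x : ℂ) = ((Real.exp^[n] x : ℝ) : ℂ) := by
  induction n with
  | zero => rfl
  | succ n ih => rw [Function.iterate_succ_apply', Function.iterate_succ_apply', ih,
      Complex.ofReal_exp]

theorem add_le_exp_iterate (n : ℕ) (x : ℝ) : x + n ≤ Real.exp^[n] x := by
  induction n with
  | zero => simp
  | succ n ih =>
    rw [Function.iterate_succ_apply']
    push_cast
    linarith [Real.add_one_le_exp (Real.exp^[n] x)]

/-- Far out on the real axis, every disk away from the origin has a contracting image in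
a disk of radius `6` under an inverse branch of `exp^[2]`. -/
theorem exists_branch_two_near_real {d : ℂ} {δ : ℝ} (hδ : 0 < δ) (hd : δ + δ ≤ ‖d‖) :
    ∃ X : ℝ, ∀ x ≥ X, ∃ g : ℂ → ℂ, ExpInvBranch 2 g (Metric.closedBall d δ) δ⁻¹ ∧
      ∀ z ∈ Metric.closedBall d δ, g z ∈ Metric.closedBall (x : ℂ) 6 := by
  have hd0 : d ≠ 0 := norm_pos_iff.mp (by linarith)
  set M := ‖Complex.log d‖ + 2 * Real.pi with hM
  have hM0 : 0 < M := by positivity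
  -- Ensures M ≤ e^x / 2, hence e^x / 2 ≤ ‖a‖ ≤ 2e^x below.
  refine ⟨2 * M + 4, fun x hx => ?_⟩
  have hexp : 2 * M + 4 ≤ Real.exp x := by linarith [Real.add_one_le_exp x]
  set k := ⌊Real.exp x / (2 * Real.pi)⌋₊ with hk
  have hpi := Real.pi_pos
  have hk1 : k * (2 * Real.pi) ≤ Real.exp x :=
    (le_div_iff₀ (by positivity)).mp (Nat.floor_le (by positivity))
  have hk2 : Real.exp x < (k + 1) * (2 * Real.pi) :=
    (div_lt_iff₀ (by positivity)).mp (Nat.lt_floor_add_one _)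
  set a : ℂ := Complex.log d + k * (2 * Real.pi * Complex.I) with ha
  have hea : Complex.exp a = d := by
    rw [ha, Complex.exp_add, Complex.exp_log hd0, Complex.exp_nat_mul_two_pi_mul_I, mul_one]
  have hkn : ‖(k * (2 * Real.pi * Complex.I) : ℂ)‖ = k * (2 * Real.pi) := by
    simp [abs_of_pos hpi]
  have ha1 : ‖a‖ ≤ Real.exp x + M := by
    have := norm_add_le (Complex.log d) (k * (2 * Real.pi * Complex.I))
    rw [hkn] at this
    linarith
  have ha2 : Real.exp x - M ≤ ‖a‖ := by
    have := norm_sub_le a (Complex.log d)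
    rw [ha, add_sub_cancel_left, hkn, ← ha] at this
    linarith
  have hapos : 0 < ‖a‖ := by linarith
  obtain ⟨l, hl, hlb⟩ := exists_log_branch hδ hd hea
  obtain ⟨m, hm, hmb⟩ := exists_log_branch (v := Complex.log a) (w := a) (r := 1) one_pos
    (by linarith) (Complex.exp_log (norm_pos_iff.mp hapos))
  have hself := Metric.mem_closedBall_self (x := d) hδ.le
  have hlball : ∀ z ∈ Metric.closedBall d δ, l z ∈ Metric.closedBall a 1 := fun z hz => by
    have := hlb.lipschitz z hz d hself
    rw [Metric.mem_closedBall, dist_eq_norm] at hz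
    rw [Metric.mem_closedBall, dist_eq_norm, ← hl]
    refine this.trans ?_
    rwa [inv_mul_le_iff₀ hδ, mul_one]
  refine ⟨m ∘ l, by simpa using hmb.comp hlb (by norm_num) hlball, fun z hz => ?_⟩
  have h1 := hmb.lipschitz _ (hlball z hz) a (Metric.mem_closedBall_self zero_le_one)
  have h2 := hlball z hz
  rw [Metric.mem_closedBall, dist_eq_norm] at h2
  rw [hm] at h1
  have hlog2 : Real.log 2 ≤ 1 := by linarith [Real.log_two_lt_d9]
  have hre1 : Real.log ‖a‖ ≤ x + Real.log 2 := by
    rw [← Real.log_exp x, ← Real.log_mul (Real.exp_pos x).ne' two_ne_zero]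
    exact Real.log_le_log hapos (by linarith)
  have hre2 : x ≤ Real.log ‖a‖ + Real.log 2 := by
    rw [← Real.log_mul hapos.ne' two_ne_zero, Real.le_log_iff_exp_le (by positivity)]
    linarith
  -- With the image radius 1 this gives 2 + π < 6, the source of the radius 6.
  have h3 : ‖Complex.log a - x‖ ≤ 1 + Real.pi := by
    refine (Complex.norm_le_abs_re_add_abs_im _).trans (add_le_add ?_ ?_)
    · rw [Complex.sub_re, Complex.log_re, Complex.ofReal_re, abs_le]
      constructor <;> linarith
    · rw [Complex.sub_im, Complex.ofReal_im, sub_zero, Complex.log_im]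
      exact Complex.abs_arg_le_pi a
  rw [Metric.mem_closedBall, dist_eq_norm, Function.comp_apply]
  have h4 := norm_add_le (m (l z) - Complex.log a) (Complex.log a - x)
  rw [sub_add_sub_cancel] at h4
  norm_num at h1
  linarith [Real.pi_lt_four]

theorem exists_branch_into_nhds {w : ℂ} {U : Set ℂ} (hU : IsOpen U) (hw : w ∈ U) {N : ℕ}
    (hN : (Complex.exp^[N] w).im = 0) {ε : ℝ} (hε : 0 < ε) (X : ℝ) :
    ∃ n : ℕ, ∃ x ≥ X, ∃ C ≥ 0, C ≤ ε ∧ ∃ g : ℂ → ℂ,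
      ExpInvBranch n g (Metric.closedBall (x : ℂ) 6) C ∧
      ∀ z ∈ Metric.closedBall (x : ℂ) 6, g z ∈ U := by
  set t := (Complex.exp^[N] w).re with ht
  have hreal : ∀ i, Complex.exp^[i + N] w = ((Real.exp^[i] t : ℝ) : ℂ) := fun i => by
    rw [Function.iterate_add_apply, ← exp_iterate_ofReal]
    congr 1
    exact Complex.ext rfl hN
  -- 8 = 6 + 2: from here on the orbit is far enough out for 1/2-Lipschitz logarithms on disks of
  -- radius 6.
  obtain ⟨K, hK⟩ := exists_nat_ge (8 - t)
  obtain ⟨ρ, hρ, C, hC, g, hgb, hgU⟩ := exists_local_branch (K + N) w U hU hw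
  obtain ⟨j₁, hj₁⟩ := exists_pow_lt_of_lt_one (show 0 < min (ε / C) (ρ / 6) by positivity)
    (show (2⁻¹ : ℝ) < 1 by norm_num)
  obtain ⟨j₂, hj₂⟩ := exists_nat_ge (X - t)
  set j := max j₁ j₂ with hj
  have hjpow : (2⁻¹ : ℝ) ^ j < min (ε / C) (ρ / 6) :=
    (pow_le_pow_of_le_one (by norm_num) (by norm_num) (le_max_left _ _)).trans_lt hj₁
  have horbit : ∀ i, Complex.exp^[i] (Complex.exp^[K + N] w) =
      ((Real.exp^[i + K] t : ℝ) : ℂ) := fun i => by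
    rw [← Function.iterate_add_apply, ← add_assoc, hreal]
  obtain ⟨h, hh, hhb⟩ := exists_branch_of_large_orbit (r := 6) (by norm_num) j
    (Complex.exp^[K + N] w) fun i _ => by
      rw [horbit, Complex.norm_real]
      refine le_trans ?_ (le_abs_self _)
      have := add_le_exp_iterate (i + 1 + K) t
      push_cast at this
      linarith [Nat.cast_nonneg (α := ℝ) i]
  rw [horbit] at hh hhb
  have hball : ∀ z ∈ Metric.closedBall ((Real.exp^[j + K] t : ℝ) : ℂ) 6,
      h z ∈ Metric.closedBall (Complex.exp^[K + N] w) ρ := fun z hz => by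
    have h1 := hhb.lipschitz z hz _ (Metric.mem_closedBall_self (by norm_num))
    rw [hh] at h1
    rw [Metric.mem_closedBall, dist_eq_norm] at hz ⊢
    have h2 := hjpow.trans_le (min_le_right _ _)
    refine h1.trans ?_
    calc (2⁻¹ : ℝ) ^ j * _ ≤ ρ / 6 * 6 := mul_le_mul h2.le hz (norm_nonneg _) (by positivity)
      _ = ρ := by ring
  refine ⟨_, Real.exp^[j + K] t, ?_, C * 2⁻¹ ^ j, by positivity, ?_, g ∘ h,
    hgb.comp hhb hC.le hball, fun z hz => hgU _ (hball z hz)⟩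
  · have h1 := add_le_exp_iterate (j + K) t
    have h2 : (j₂ : ℝ) ≤ j := by exact_mod_cast le_max_right j₁ j₂
    push_cast at h1
    linarith [Nat.cast_nonneg (α := ℝ) K]
  · have h2 := hjpow.trans_le (min_le_left _ _)
    rw [lt_div_iff₀ hC] at h2
    linarith

theorem theorem5p7 (U : Set ℂ) (hU : IsOpen U) (hne : U.Nonempty) :
    ∃ p ∈ U, ∃ n : ℕ, 1 ≤ n ∧ Function.IsPeriodicPt Complex.exp n p ∧
      1 < ‖deriv (Complex.exp^[n]) p‖ := by
  obtain ⟨d, hdU, hd0⟩ : ∃ d ∈ U, d ≠ 0 := by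
    obtain ⟨d, hd⟩ := (dense_compl_singleton (0 : ℂ)).inter_open_nonempty U hU hne
    exact ⟨d, hd⟩
  obtain ⟨ε, hε, hεU⟩ := Metric.isOpen_iff.mp hU d hdU
  have hdpos : 0 < ‖d‖ := norm_pos_iff.mpr hd0
  obtain ⟨δ, hδ, hδε, hδd⟩ : ∃ δ > 0, δ ≤ ε ∧ δ + δ ≤ ‖d‖ :=
    ⟨min ε (‖d‖ / 2), by positivity, min_le_left _ _, by linarith [min_le_right ε (‖d‖ / 2)]⟩
  obtain ⟨w, hw, N, hN⟩ := exists_im_exp_iterate_eq_zero (z := d) hδ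
  obtain ⟨X, hX⟩ := exists_branch_two_near_real hδ hδd
  obtain ⟨n, x, hx, C, hC, hCδ, g, hgb, hgU⟩ :=
    -- `δ / 2` offsets the factor `δ⁻¹` of the double logarithm, leaving 1/2.
    exists_branch_into_nhds Metric.isOpen_ball hw hN (ε := δ / 2) (by positivity) X
  obtain ⟨h, hhb, hh⟩ := hX x hx
  have hb := hgb.comp hhb hC hh
  have hb' : ExpInvBranch (2 + n) (g ∘ h) (Metric.closedBall d δ) 2⁻¹ :=
    ⟨hb.right_inv, fun z hz z' hz' => (hb.lipschitz z hz z' hz').trans <| by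
      refine mul_le_mul_of_nonneg_right ?_ (norm_nonneg _)
      rw [← div_eq_mul_inv, div_le_iff₀ hδ]
      linarith⟩
  obtain ⟨p, hp, hper, hrep⟩ := hb'.exists_repelling hδ fun z hz => hgU _ (hh z hz)
  exact ⟨p, hεU (Metric.ball_subset_ball hδε hp), 2 + n, by omega, hper, hrep⟩
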